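/- Let $\mathsf h$ be a complex separable Hilbert space and $\mathcal B(\mathsf h)$ the algebra of bounded operators on $\mathsf h$, with the weak$^*$ topology it carries as the dual of the trace class operators (the coarsest topology making $x\mapsto \operatorname{tr}(\eta x)$ continuous for every trace class operator $\eta$). Let $\mathcal T=(\mathcal T_t)_{t\ge 0}$ be a quantum Markov semigroup on $\mathcal B(\mathsf h)$, i.e. a family of completely positive linear maps on $\mathcal B(\mathsf h)$ with $\mathcal T_t(\mathbf 1)=\mathbf 1$ for all $t\ge 0$, each of them normal (continuous for the weak$^*$ topology), such that $\mathcal T_0$ is the identity map, $\mathcal T_{s+t}=\mathcal T_s\mathcal T_t$ for all $s,t\ge 0$, and $t\mapsto\mathcal T_t(x)$ is weak$^*$ continuous on $[0,\infty)$ for every $x\in\mathcal B(\mathsf h)$. Let $\rho$ be an invariant density, i.e. a positive trace class operator on $\mathsf h$ with $\operatorname{tr}(\rho)=1$ and $\operatorname{tr}(\rho\,\mathcal T_t(x))=\operatorname{tr}(\rho x)$ for all $t\ge 0$ and $x\in\mathcal B(\mathsf h)$. Then the support projection $p$ of $\rho$, that is, the orthogonal projection onto the closure of the range of $\rho$, is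 subharmonic: $p$ is an orthogonal projection and $\mathcal T_t(p)\ge p$ for all $t\ge 0$. -/

import Mathlib

open scoped InnerProductSpace NNReal Topology CStarAlgebra

noncomputable section

namespace QuantumMarkov

variable {H : Type*} [NormedAddCommGroup H] [InnerProductSpace ℂ H] [CompleteSpace H]

variable (H) in
/-- Index set of a fixed orthonormal basis of `H`. -/
def basisIndex : Set H := (exists_hilbertBasis ℂ H).choose

variable (H) in
/-- A fixed orthonormal (Hilbert) basis of `H`, used to compute traces. -/
def basis : HilbertBasis (basisIndex H) ℂ H := (exists_hilbertBasis ℂ H).choose_spec.choose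

/-- `A` is trace class: `∑ᵢ ⟨eᵢ, |A| eᵢ⟩ < ∞`, where `|A| = (A* A)^{1/2}`. The terms are
nonnegative reals, and the condition does not depend on the orthonormal basis. -/
def IsTraceClass (A : H →L[ℂ] H) : Prop :=
  Summable fun i => (⟪basis H i, CFC.abs A (basis H i)⟫_ℂ).re

/-- The trace `∑ᵢ ⟨eᵢ, A eᵢ⟩`; for trace class `A` the series converges absolutely and its sum
does not depend on the orthonormal basis. It is only used on trace class operators. -/
def trace (A : H →L[ℂ] H) : ℂ :=
  ∑' i, ⟪basis H i, A (basis H i)⟫_ℂ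

variable (H) in
/-- The weak* topology of `B(H)` as the dual of the trace class operators: the coarsest topology
for which `x ↦ tr(η x)` is continuous for every trace class `η`. -/
@[reducible] def weakStar : TopologicalSpace (H →L[ℂ] H) :=
  ⨅ η : {η : H →L[ℂ] H // IsTraceClass η},
    TopologicalSpace.induced (fun x => trace (η.1 * x)) inferInstance

variable (H) in
/-- A quantum Markov semigroup on `B(H)`: a weak*-continuous one-parameter semigroup of completely
positive, identity preserving, normal maps. -/
structure QMS where
  /-- The completely positive maps `T_t`, `t ≥ 0`. -/
  map : ℝ≥0 → ((H →L[ℂ] H) →CP (H →L[ℂ] H))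
  map_zero : ∀ x, map 0 x = x
  map_add : ∀ s t x, map (s + t) x = map s (map t x)
  map_one : ∀ t, map t 1 = 1
  normal : ∀ t, Continuous[weakStar H, weakStar H] (map t)
  weakStar_continuous : ∀ x, Continuous[inferInstance, weakStar H] (fun t => map t x)

/-- A density: a positive trace class operator of unit trace. -/
structure IsDensity (ρ : H →L[ℂ] H) : Prop where
  nonneg : 0 ≤ ρ
  traceClass : IsTraceClass ρ
  trace_eq_one : trace ρ = 1

/-- The density `ρ` is invariant for `T`: `tr(ρ T_t(x)) = tr(ρ x)` for all `t ≥ 0` and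
`x ∈ B(H)`. As the predual map `T_{*t}` is determined by `tr(T_{*t}(η) x) = tr(η T_t(x))`,
this says `T_{*t}(ρ) = ρ`. -/
def QMS.IsInvariantDensity (T : QMS H) (ρ : H →L[ℂ] H) : Prop :=
  IsDensity ρ ∧ ∀ t x, trace (ρ * T.map t x) = trace (ρ * x)

/-- The support projection: the orthogonal projection onto the closure of the range of `ρ`. -/
def supportProjection (ρ : H →L[ℂ] H) : H →L[ℂ] H :=
  (LinearMap.range (ρ : H →ₗ[ℂ] H)).topologicalClosure.starProjection

/-- `p` is subharmonic for `T`: an orthogonal projection with `T_t(p) ≥ p` for all `t ≥ 0`. -/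
def QMS.IsSubharmonic (T : QMS H) (p : H →L[ℂ] H) : Prop :=
  IsStarProjection p ∧ ∀ t, p ≤ T.map t p

end QuantumMarkov

end

/-! Each `T_t` is positive and unital, so `0 ≤ T_t(p) ≤ 1`, and invariance gives
`tr(ρ T_t(p)) = tr(ρ p) = tr(ρ)`. Thus `y = 1 - T_t(p)` is positive with `tr(ρ y) = 0`. By
cyclicity of the trace this number is the sum of the nonnegative terms `⟪√ρ eᵢ, y √ρ eᵢ⟫`, so `y`
annihilates the range of `ρ`, hence `T_t(p) p = p` and `T_t(p) - p = (1 - p) T_t(p) (1 - p) ≥ 0`. -/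

namespace QuantumMarkov

section HilbertSchmidt

variable {𝕜 ι κ E F G : Type*} [RCLike 𝕜]
  [NormedAddCommGroup E] [InnerProductSpace 𝕜 E] [NormedAddCommGroup F] [InnerProductSpace 𝕜 F]
  [NormedAddCommGroup G] [InnerProductSpace 𝕜 G]

theorem hasSum_norm_inner_sq (b : HilbertBasis ι 𝕜 E) (x : E) :
    HasSum (fun i => ‖⟪b i, x⟫_𝕜‖ ^ 2) (‖x‖ ^ 2) := by
  simpa [b.repr_apply_apply] using lp.hasSum_norm (p := 2) (by norm_num) (b.repr x)

/-- `A` is Hilbert–Schmidt: `∑ᵢ ‖A bᵢ‖² < ∞`. The condition does not depend on the basis `b`, but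
fixing `b` in the definition spares us the proof of this. -/
def IsHilbertSchmidt (b : HilbertBasis ι 𝕜 E) (A : E →L[𝕜] F) : Prop :=
  Summable fun i => ‖A (b i)‖ ^ 2

namespace IsHilbertSchmidt

variable {b : HilbertBasis ι 𝕜 E} {A B : E →L[𝕜] F}

theorem comp_left (hA : IsHilbertSchmidt b A) (T : F →L[𝕜] G) : IsHilbertSchmidt b (T ∘L A) := by
  refine (hA.mul_left (‖T‖ ^ 2)).of_nonneg_of_le (fun _ => by positivity) fun i => ?_
  rw [← mul_pow]
  gcongr
  exact T.le_opNorm (A (b i))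

theorem summable_norm_inner_sq (hA : IsHilbertSchmidt b A) (c : HilbertBasis κ 𝕜 F) :
    Summable fun q : ι × κ => ‖⟪c q.2, A (b q.1)⟫_𝕜‖ ^ 2 := by
  refine (summable_prod_of_nonneg fun _ => by positivity).2
    ⟨fun i => (hasSum_norm_inner_sq c (A (b i))).summable, ?_⟩
  simpa only [(hasSum_norm_inner_sq c (A (b _))).tsum_eq] using! hA

theorem summable_inner (hA : IsHilbertSchmidt b A) (hB : IsHilbertSchmidt b B) :
    Summable fun i => ⟪A (b i), B (b i)⟫_𝕜 := by
  refine (hA.add hB).of_norm_bounded fun i => ?_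
  have h_nonneg : 0 ≤ ‖A (b i)‖ * ‖B (b i)‖ := by positivity
  linarith [norm_inner_le_norm (𝕜 := 𝕜) (A (b i)) (B (b i)),
    two_mul_le_add_sq ‖A (b i)‖ ‖B (b i)‖]

theorem summable_inner_mul_inner (hA : IsHilbertSchmidt b A) (hB : IsHilbertSchmidt b B)
    (c : HilbertBasis κ 𝕜 F) :
    Summable fun q : ι × κ => ⟪A (b q.1), c q.2⟫_𝕜 * ⟪c q.2, B (b q.1)⟫_𝕜 := by
  refine ((hA.summable_norm_inner_sq c).add (hB.summable_norm_inner_sq c)).of_norm_bounded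
    fun q => ?_
  rw [norm_mul, norm_inner_symm]
  have h_nonneg : 0 ≤ ‖⟪c q.2, A (b q.1)⟫_𝕜‖ * ‖⟪c q.2, B (b q.1)⟫_𝕜‖ := by positivity
  linarith [two_mul_le_add_sq ‖⟪c q.2, A (b q.1)⟫_𝕜‖ ‖⟪c q.2, B (b q.1)⟫_𝕜‖]

/-- Cyclicity of the trace, `tr(A* B) = tr(B A*)`. -/
theorem tsum_inner_eq_tsum_inner_adjoint [CompleteSpace E] [CompleteSpace F]
    (hA : IsHilbertSchmidt b A) (hB : IsHilbertSchmidt b B) (c : HilbertBasis κ 𝕜 F) :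
    ∑' i, ⟪A (b i), B (b i)⟫_𝕜 = ∑' j, ⟪B.adjoint (c j), A.adjoint (c j)⟫_𝕜 :=
  calc ∑' i, ⟪A (b i), B (b i)⟫_𝕜
    _ = ∑' i, ∑' j, ⟪A (b i), c j⟫_𝕜 * ⟪c j, B (b i)⟫_𝕜 := by
      simp only [c.tsum_inner_mul_inner]
    _ = ∑' j, ∑' i, ⟪A (b i), c j⟫_𝕜 * ⟪c j, B (b i)⟫_𝕜 :=
      (Summable.tsum_comm (f := fun i j => ⟪A (b i), c j⟫_𝕜 * ⟪c j, B (b i)⟫_𝕜)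
        (hA.summable_inner_mul_inner hB c)).symm
    _ = ∑' j, ∑' i, ⟪B.adjoint (c j), b i⟫_𝕜 * ⟪b i, A.adjoint (c j)⟫_𝕜 := by
      simp only [ContinuousLinearMap.adjoint_inner_left, ContinuousLinearMap.adjoint_inner_right,
        mul_comm]
    _ = ∑' j, ⟪B.adjoint (c j), A.adjoint (c j)⟫_𝕜 := by simp only [b.tsum_inner_mul_inner]

end IsHilbertSchmidt

end HilbertSchmidt

theorem le_of_isStarProjection_of_mul_eq {R : Type*} [Ring R] [PartialOrder R] [StarRing R]
    [StarOrderedRing R] {p x : R} (hp : IsStarProjection p) (hx : 0 ≤ x) (h : x * p = p) :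
    p ≤ x := by
  have h_star : p * x = p := by
    simpa [hp.isSelfAdjoint.star_eq, hx.isSelfAdjoint.star_eq] using congrArg star h
  have h_corner : (1 - p) * x * (1 - p) = x - p := by
    simp [sub_mul, mul_sub, h, h_star, hp.isIdempotentElem.eq]
  exact sub_nonneg.1 (h_corner ▸ hp.one_sub.isSelfAdjoint.conjugate_nonneg hx)

variable {H : Type*} [NormedAddCommGroup H] [InnerProductSpace ℂ H] [CompleteSpace H]
  {ρ x y : H →L[ℂ] H}

theorem inner_sqrt_apply_sqrt_apply (hρ : 0 ≤ ρ) (v w : H) :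
    ⟪CFC.sqrt ρ v, CFC.sqrt ρ w⟫_ℂ = ⟪v, ρ w⟫_ℂ := by
  rw [← ContinuousLinearMap.adjoint_inner_right, (CFC.sqrt_nonneg ρ).isSelfAdjoint.adjoint_eq,
    ← mul_apply_eq_comp, CFC.sqrt_mul_sqrt_self ρ hρ]

theorem apply_eq_zero_of_inner_eq_zero (hy : 0 ≤ y) {v : H} (h : ⟪v, y v⟫_ℂ = 0) : y v = 0 := by
  have h_sqrt : CFC.sqrt y v = 0 := by
    rwa [← inner_sqrt_apply_sqrt_apply hy, inner_self_eq_zero] at h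
  rw [← CFC.sqrt_mul_sqrt_self y hy, mul_apply_eq_comp, h_sqrt, map_zero]

theorem IsTraceClass.isHilbertSchmidt_sqrt (hρ : IsTraceClass ρ) (h₀ : 0 ≤ ρ) :
    IsHilbertSchmidt (basis H) (CFC.sqrt ρ) := by
  rw [IsTraceClass, CFC.abs_of_nonneg ρ h₀] at hρ
  refine hρ.congr fun i => ?_
  rw [← inner_sqrt_apply_sqrt_apply h₀, inner_self_eq_norm_sq_to_K]
  norm_cast

theorem IsTraceClass.hasSum_trace_mul (hρ : IsTraceClass ρ) (h₀ : 0 ≤ ρ) (x : H →L[ℂ] H) :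
    HasSum (fun i => ⟪CFC.sqrt ρ (basis H i), x (CFC.sqrt ρ (basis H i))⟫_ℂ) (trace (ρ * x)) := by
  have h_sqrt := hρ.isHilbertSchmidt_sqrt h₀
  have h_adjoint : (CFC.sqrt ρ).adjoint = CFC.sqrt ρ :=
    (CFC.sqrt_nonneg ρ).isSelfAdjoint.adjoint_eq
  have h_trace : trace (ρ * x) = ∑' i, ⟪CFC.sqrt ρ (basis H i), x (CFC.sqrt ρ (basis H i))⟫_ℂ :=
    calc trace (ρ * x)
      _ = ∑' i, ⟪CFC.sqrt ρ (basis H i), CFC.sqrt ρ (x (basis H i))⟫_ℂ := by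
        simp only [trace, mul_apply_eq_comp, inner_sqrt_apply_sqrt_apply h₀]
      _ = ∑' i, ⟪x.adjoint (CFC.sqrt ρ (basis H i)), CFC.sqrt ρ (basis H i)⟫_ℂ := by
        simpa [ContinuousLinearMap.adjoint_comp, h_adjoint] using
          ((h_sqrt.comp_left x.adjoint).tsum_inner_eq_tsum_inner_adjoint h_sqrt (basis H)).symm
      _ = ∑' i, ⟪CFC.sqrt ρ (basis H i), x (CFC.sqrt ρ (basis H i))⟫_ℂ := by
        simp only [ContinuousLinearMap.adjoint_inner_left]
  exact h_trace ▸ (h_sqrt.summable_inner (h_sqrt.comp_left x)).hasSum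

theorem IsTraceClass.trace_mul_sub (hρ : IsTraceClass ρ) (h₀ : 0 ≤ ρ) (x y : H →L[ℂ] H) :
    trace (ρ * (x - y)) = trace (ρ * x) - trace (ρ * y) := by
  refine (hρ.hasSum_trace_mul h₀ (x - y)).unique ?_
  simpa only [sub_apply, inner_sub_right] using
    (hρ.hasSum_trace_mul h₀ x).sub (hρ.hasSum_trace_mul h₀ y)

open scoped ComplexOrder in
theorem IsTraceClass.mul_eq_zero_of_trace_mul_eq_zero (hρ : IsTraceClass ρ) (h₀ : 0 ≤ ρ)
    (hy : 0 ≤ y) (h : trace (ρ * y) = 0) : y * ρ = 0 := by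
  have h_pos := (ContinuousLinearMap.nonneg_iff_isPositive y).1 hy
  have h_inner := (hasSum_zero_iff_of_nonneg fun i =>
    h_pos.inner_nonneg_right (CFC.sqrt ρ (basis H i))).1 (h ▸ hρ.hasSum_trace_mul h₀ y)
  have h_sqrt : y * CFC.sqrt ρ = 0 :=
    ContinuousLinearMap.ext_on
      (Submodule.dense_iff_topologicalClosure_eq_top.2 (basis H).dense_span)
      (Set.forall_mem_range.2 fun i => apply_eq_zero_of_inner_eq_zero hy (congrFun h_inner i))
  rw [← CFC.sqrt_mul_sqrt_self ρ h₀, ← mul_assoc, h_sqrt, zero_mul]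

theorem isStarProjection_supportProjection (ρ : H →L[ℂ] H) :
    IsStarProjection (supportProjection ρ) :=
  isStarProjection_starProjection

theorem mul_supportProjection_of_isSelfAdjoint (hρ : IsSelfAdjoint ρ) :
    ρ * supportProjection ρ = ρ := by
  have h : supportProjection ρ * ρ = ρ := by
    ext v
    exact Submodule.starProjection_eq_self_iff.2
      (Submodule.le_topologicalClosure _ (LinearMap.mem_range_self _ v))
  simpa [hρ.star_eq, (isStarProjection_supportProjection ρ).isSelfAdjoint.star_eq] using
    congrArg star h

theorem mul_supportProjection_eq_zero (h : y * ρ = 0) : y * supportProjection ρ = 0 := by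
  have h_le : (LinearMap.range (ρ : H →ₗ[ℂ] H)).topologicalClosure ≤
      LinearMap.ker (y : H →ₗ[ℂ] H) := by
    refine Submodule.topologicalClosure_minimal _ ?_ y.isClosed_ker
    rintro _ ⟨v, rfl⟩
    exact DFunLike.congr_fun h v
  ext v
  exact h_le (Submodule.starProjection_apply_mem _ v)

theorem IsTraceClass.supportProjection_le_of_trace_mul_eq (hρ : IsTraceClass ρ) (h₀ : 0 ≤ ρ)
    (hx₀ : 0 ≤ x) (hx₁ : x ≤ 1) (h : trace (ρ * x) = trace ρ) : supportProjection ρ ≤ x := by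
  have h_trace : trace (ρ * (1 - x)) = 0 := by
    rw [hρ.trace_mul_sub h₀, mul_one, h, sub_self]
  have h_support : (1 - x) * supportProjection ρ = 0 :=
    mul_supportProjection_eq_zero
      (hρ.mul_eq_zero_of_trace_mul_eq_zero h₀ (sub_nonneg.2 hx₁) h_trace)
  rw [sub_mul, one_mul, sub_eq_zero] at h_support
  exact le_of_isStarProjection_of_mul_eq (isStarProjection_supportProjection ρ) hx₀ h_support.symm

end QuantumMarkov

open QuantumMarkov in
theorem proposition2p1_general {H : Type*} [NormedAddCommGroup H] [InnerProductSpace ℂ H]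
    [CompleteSpace H] (S : (H →L[ℂ] H) →ₚ[ℂ] (H →L[ℂ] H)) (hS : S 1 ≤ 1) {ρ : H →L[ℂ] H}
    (hρ : IsTraceClass ρ) (h₀ : 0 ≤ ρ) (h_inv : ∀ x, trace (ρ * S x) = trace (ρ * x)) :
    supportProjection ρ ≤ S (supportProjection ρ) := by
  have hp := isStarProjection_supportProjection ρ
  have h_le_one : S (supportProjection ρ) ≤ 1 := (OrderHomClass.mono S hp.le_one).trans hS
  have h_trace : trace (ρ * S (supportProjection ρ)) = trace ρ := by
    rw [h_inv, mul_supportProjection_of_isSelfAdjoint h₀.isSelfAdjoint]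
  exact hρ.supportProjection_le_of_trace_mul_eq h₀ (S.map_nonneg hp.nonneg) h_le_one h_trace

theorem proposition2p1 {H : Type*} [NormedAddCommGroup H] [InnerProductSpace ℂ H]
    [CompleteSpace H] [TopologicalSpace.SeparableSpace H]
    (T : QuantumMarkov.QMS H) (ρ : H →L[ℂ] H) (hρ : T.IsInvariantDensity ρ) :
    T.IsSubharmonic (QuantumMarkov.supportProjection ρ) :=
  ⟨QuantumMarkov.isStarProjection_supportProjection ρ, fun t =>
    proposition2p1_general (.ofClass (T.map t)) (T.map_one t).le hρ.1.traceClass hρ.1.nonneg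
      (hρ.2 t)⟩
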